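/- Let $r\in[1/3,1/2]$, let $D_r\subset\mathbb R^2$ be the closed disk of radius $r$ centred at a point $O$, and let $A,B,C$ be points at distance $1-r$ from $O$. For $P\in\{A,B,C\}$ let $\mathcal C_P=\operatorname{conv}(D_r\cup\{P\})\setminus D_r$ be the cap at $P$, and assume that the three caps are pairwise disjoint. Let $T_{ABC}=\operatorname{conv}(D_r\cup\{A,B,C\})$ (a "three-$r$-cap"). Let $u$ be the torsion function of $T_{ABC}$, that is, the weak solution of $-\Delta u=1$, $u\in H^1_0(\operatorname{int}T_{ABC})$, taken in its representative that is continuous in the interior, with value $0$ on $\partial T_{ABC}$. Put $\alpha=\arccos\frac{r}{1-r}$, and for $P\in\{B,C\}$ let $\gamma_P:[0,2\alpha]\to\partial D_r$ be the parametrization by angle, in the positive (counterclockwise) sense, of the arc of $\partial D_r$ which joins the contact points of the two tangents from $P$ to $D_r$ and is centred on the ray $OP$; that is, $\gamma_P(t)=O+r\,(\cos(\beta_P-\alpha+t),\sin(\beta_P-\alpha+t))$, where $\beta_P$ is the polar angle of $P-O$. If $AB<AC$, then $$u(\gamma_B(t))\ \ge\ u(\gamma_C(2\alpha-t))\qquad\text{for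 every } t\in[0,2\alpha].$$ -/

import Mathlib

open MeasureTheory Filter Topology
open scoped Distributions Gradient

/-! ### The space `H¹₀` of a planar open set and the torsion problem

The Euclidean plane is `ℂ`, with its real inner product and Lebesgue measure. `𝓓(Ω, ℝ)` is
Mathlib's space of smooth real functions with compact support contained in the open set `Ω`. -/

/-- `G` is the weak (distributional) gradient of `u` in `Ω`. -/
def HasWeakGradient (Ω : TopologicalSpace.Opens ℂ) (u : ℂ → ℝ) (G : ℂ → ℂ) : Prop :=
  ∀ φ : 𝓓(Ω, ℝ), ∫ x in (Ω : Set ℂ), u x • ∇ (φ : ℂ → ℝ) x = -∫ x in (Ω : Set ℂ), φ x • G x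

/-- `u` belongs to `H¹₀(Ω)` and its weak gradient is `G`: both `u` and `G` are square integrable on
`Ω`, and `u` is a limit, in the norm of `H¹(Ω)`, of smooth functions with compact support in `Ω`. -/
structure MemH10 (Ω : TopologicalSpace.Opens ℂ) (u : ℂ → ℝ) (G : ℂ → ℂ) : Prop where
  memLp : MemLp u 2 (volume.restrict (Ω : Set ℂ))
  memLp_grad : MemLp G 2 (volume.restrict (Ω : Set ℂ))
  hasWeakGradient : HasWeakGradient Ω u G
  exists_approx : ∃ φ : ℕ → 𝓓(Ω, ℝ),
    Tendsto (fun n => eLpNorm (fun x => φ n x - u x) 2 (volume.restrict (Ω : Set ℂ)))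
      atTop (𝓝 0) ∧
    Tendsto (fun n => eLpNorm (fun x => ∇ (φ n : ℂ → ℝ) x - G x) 2
      (volume.restrict (Ω : Set ℂ))) atTop (𝓝 0)

/-- `u` is a weak solution of `-Δu = 1`, `u ∈ H¹₀(Ω)`. -/
def IsWeakTorsionSolution (Ω : TopologicalSpace.Opens ℂ) (u : ℂ → ℝ) : Prop :=
  ∃ G : ℂ → ℂ, MemH10 Ω u G ∧
    ∀ φ : 𝓓(Ω, ℝ), ∫ x in (Ω : Set ℂ), inner ℝ (G x) (∇ (φ : ℂ → ℝ) x) =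
      ∫ x in (Ω : Set ℂ), φ x

/-- `u` is the torsion function of the closed planar set `K`: the weak solution of `-Δu = 1`,
`u ∈ H¹₀(int K)`. Its pointwise values are those of the representative which is continuous in the
interior of `K`, with value `0` on the boundary of `K`. -/
structure IsTorsionFunction (K : Set ℂ) (u : ℂ → ℝ) : Prop where
  weakSolution : IsWeakTorsionSolution ⟨interior K, isOpen_interior⟩ u
  continuousOn : ContinuousOn u (interior K)
  zero_frontier : ∀ x ∈ frontier K, u x = 0

/-! ### Three-`r`-caps -/

/-- The cap at the vertex `P`: the region outside the disk of centre `O` and radius `r` which is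
enclosed by the two tangents from `P` to the disk. It is the part of the convex hull of the disk
and `P` which lies outside the disk. -/
def cap (O : ℂ) (r : ℝ) (P : ℂ) : Set ℂ :=
  convexHull ℝ (insert P (Metric.closedBall O r)) \ Metric.closedBall O r

/-- The set `T_{ABC}`: the convex hull of the disk of centre `O` and radius `r` and of the three
points `A`, `B`, `C`. -/
def capHull (O : ℂ) (r : ℝ) (A B C : ℂ) : Set ℂ :=
  convexHull ℝ (Metric.closedBall O r ∪ {A, B, C})

/-- The set `capHull O r A B C` is a three-`r`-cap: `r ∈ [1/3, 1/2]`, the vertices `A`, `B`, `C` lie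
at distance `1 - r` from `O`, and the caps at `A`, `B`, `C` are pairwise disjoint. -/
structure IsThreeCap (O : ℂ) (r : ℝ) (A B C : ℂ) : Prop where
  r_mem : r ∈ Set.Icc (1 / 3 : ℝ) (1 / 2)
  dist_A : dist A O = 1 - r
  dist_B : dist B O = 1 - r
  dist_C : dist C O = 1 - r
  disjoint_AB : Disjoint (cap O r A) (cap O r B)
  disjoint_AC : Disjoint (cap O r A) (cap O r C)
  disjoint_BC : Disjoint (cap O r B) (cap O r C)

/-- The angle `α` with `cos α = r / (1 - r)`. For a vertex `P` at distance `1 - r` from `O`, the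
tangents from `P` touch the circle of centre `O` and radius `r` at the two points seen from `O`
at angles `-α` and `α` from the direction of `P`. -/
noncomputable def capAngle (r : ℝ) : ℝ := Real.arccos (r / (1 - r))

/-- The arc `γ_P : [0, 2α] → ∂D_r` cut out by the tangents from the vertex `P`, parametrized by
angle in the positive trigonometric sense. It starts at the contact point at angle `-α` from the
direction of `P` and ends at the contact point at angle `α`. -/
noncomputable def capArc (O : ℂ) (r : ℝ) (P : ℂ) (t : ℝ) : ℂ :=
  O + r * Complex.exp (((P - O).arg - capAngle r + t : ℝ) * Complex.I)

/-! Let `σ` be the reflection across the perpendicular bisector of `BC`, a line through `O`. Since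
`A` lies on the side of `B`, `σ` maps the part of the hull on the side of `C` into the hull
(`reflectAbout_mem_capHull`). Polarization, which moves the larger of the values at `x` and `σ x` to
the side of `B`, keeps the integral and does not increase the Dirichlet energy
(`torsionEnergy_polarize_le`). As the torsion function minimizes the torsion energy, it is its own
polarization: `u x ≤ u (σ x)` on the side of `C` (`IsWeakTorsionSolution.le_comp_reflection`).
Disjointness of the caps keeps the arc at `B` on the side of `B` (`bisectorSide_capArc_nonneg`), and
`σ` carries it to the arc at `C` traversed backwards.

Everything is done on approximating test functions, with `smoothRamp` in place of the positive part
so that polarization stays smooth. The energy is, up to a constant, the squared distance of the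
gradient to that of `u`; so a modification which does not raise the energy, up to an error tending
to zero, still converges to `u`. The amount transferred by polarization therefore tends to zero.
Applied to the ramp itself, the same principle yields nonnegative approximants, which polarization
needs in order to keep supports inside the domain. -/

/-! ### A smooth ramp -/

/-- A smooth approximation of the positive part, which vanishes on `(-∞, ε]`. -/
noncomputable def smoothRamp (ε s : ℝ) : ℝ := ∫ t in ε..s, Real.smoothTransition (t / ε - 1)

theorem continuous_smoothTransition_div_sub (ε : ℝ) :
    Continuous fun t : ℝ => Real.smoothTransition (t / ε - 1) :=
  Real.smoothTransition.continuous.comp (by fun_prop)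

theorem hasDerivAt_smoothRamp (ε s : ℝ) :
    HasDerivAt (smoothRamp ε) (Real.smoothTransition (s / ε - 1)) s :=
  intervalIntegral.integral_hasDerivAt_right
    ((continuous_smoothTransition_div_sub ε).intervalIntegrable _ _)
    ((continuous_smoothTransition_div_sub ε).stronglyMeasurableAtFilter _ _)
    (continuous_smoothTransition_div_sub ε).continuousAt

theorem contDiff_smoothRamp (ε : ℝ) : ContDiff ℝ (⊤ : ℕ∞) (smoothRamp ε) := by
  rw [contDiff_infty_iff_deriv]
  refine ⟨fun s => (hasDerivAt_smoothRamp ε s).differentiableAt, ?_⟩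
  have : deriv (smoothRamp ε) = fun s => Real.smoothTransition (s / ε - 1) :=
    funext fun s => (hasDerivAt_smoothRamp ε s).deriv
  rw [this]
  exact Real.smoothTransition.contDiff.comp (by fun_prop)

theorem smoothRamp_of_le {ε s : ℝ} (hε : 0 < ε) (hs : s ≤ ε) : smoothRamp ε s = 0 := by
  have : Set.EqOn (fun t : ℝ => Real.smoothTransition (t / ε - 1)) (fun _ => 0)
      (Set.uIcc ε s) := by
    intro t ht
    rw [Set.uIcc_of_ge hs] at ht
    refine Real.smoothTransition.zero_of_nonpos ?_
    have : t / ε ≤ 1 := (div_le_one hε).2 ht.2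
    linarith
  rw [smoothRamp, intervalIntegral.integral_congr this]
  simp

theorem smoothRamp_nonneg {ε : ℝ} (hε : 0 < ε) (s : ℝ) : 0 ≤ smoothRamp ε s := by
  rcases le_total s ε with h | h
  · exact (smoothRamp_of_le hε h).ge
  · exact intervalIntegral.integral_nonneg h fun t _ => Real.smoothTransition.nonneg _

/-- The integrand equals `1` from `2 * ε` on, so the ramp has slope one there and starts from a
nonnegative value. -/
theorem sub_le_smoothRamp {ε : ℝ} (hε : 0 < ε) (s : ℝ) : s - 2 * ε ≤ smoothRamp ε s := by
  rcases le_total s (2 * ε) with h | h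
  · exact (sub_nonpos.2 h).trans (smoothRamp_nonneg hε s)
  · have hi := fun a b : ℝ =>
      (continuous_smoothTransition_div_sub ε).intervalIntegrable (μ := volume) a b
    have h1 : ∫ t in (2 * ε)..s, Real.smoothTransition (t / ε - 1) = s - 2 * ε := by
      have : Set.EqOn (fun t : ℝ => Real.smoothTransition (t / ε - 1)) (fun _ => 1)
          (Set.uIcc (2 * ε) s) := by
        intro t ht
        rw [Set.uIcc_of_le h] at ht
        refine Real.smoothTransition.one_of_one_le ?_
        have : 2 ≤ t / ε := (le_div_iff₀ hε).2 ht.1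
        linarith
      rw [intervalIntegral.integral_congr this]
      simp
    have h2 := smoothRamp_nonneg hε (2 * ε)
    have h3 := intervalIntegral.integral_add_adjacent_intervals (hi ε (2 * ε)) (hi (2 * ε) s)
    unfold smoothRamp at *
    linarith

/-! ### Test functions and the Dirichlet energy -/

section Energy

variable {Ω : TopologicalSpace.Opens ℂ}

theorem ContDiff.continuous_gradient {f : ℂ → ℝ} (hf : ContDiff ℝ (⊤ : ℕ∞) f) :
    Continuous (∇ f) :=
  (InnerProductSpace.toDual ℝ ℂ).symm.continuous.comp (hf.continuous_fderiv (by simp))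

theorem norm_gradient_eq (f : ℂ → ℝ) (x : ℂ) : ‖∇ f x‖ = ‖fderiv ℝ f x‖ := by
  simp [gradient]

theorem gradient_eq_zero_of_notMem_tsupport {f : ℂ → ℝ} {x : ℂ} (hx : x ∉ tsupport f) :
    ∇ f x = 0 := by
  rw [← norm_eq_zero, norm_gradient_eq,
    show fderiv ℝ f x = 0 from image_eq_zero_of_notMem_tsupport
      fun h => hx (tsupport_fderiv_subset ℝ h), norm_zero]

theorem HasCompactSupport.gradient {f : ℂ → ℝ} (hf : HasCompactSupport f) :
    HasCompactSupport (∇ f) :=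
  HasCompactSupport.intro hf fun _ hx => gradient_eq_zero_of_notMem_tsupport hx

theorem TestFunction.memLp (φ : 𝓓(Ω, ℝ)) : MemLp φ 2 (volume : Measure ℂ) :=
  φ.continuous.memLp_of_hasCompactSupport φ.hasCompactSupport

theorem TestFunction.memLp_gradient (φ : 𝓓(Ω, ℝ)) : MemLp (∇ (φ : ℂ → ℝ)) 2 (volume : Measure ℂ) :=
  φ.contDiff.continuous_gradient.memLp_of_hasCompactSupport φ.hasCompactSupport.gradient

theorem TestFunction.integrable_sq_gradient (φ : 𝓓(Ω, ℝ)) :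
    Integrable (fun x => ‖∇ (φ : ℂ → ℝ) x‖ ^ 2) (volume : Measure ℂ) :=
  φ.memLp_gradient.norm.integrable_sq

theorem TestFunction.eq_zero_of_notMem (φ : 𝓓(Ω, ℝ)) {x : ℂ} (hx : x ∉ (Ω : Set ℂ)) : φ x = 0 :=
  image_eq_zero_of_notMem_tsupport fun h => hx (φ.tsupport_subset h)

theorem TestFunction.gradient_eq_zero_of_notMem (φ : 𝓓(Ω, ℝ)) {x : ℂ} (hx : x ∉ (Ω : Set ℂ)) :
    ∇ (φ : ℂ → ℝ) x = 0 :=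
  gradient_eq_zero_of_notMem_tsupport fun h => hx (φ.tsupport_subset h)

/-- The functional whose minimizer on `H¹₀` is the torsion function. -/
noncomputable def torsionEnergy (f : ℂ → ℝ) : ℝ := (∫ x, ‖∇ f x‖ ^ 2) - 2 * ∫ x, f x

/-- Expand the square; the weak equation turns the cross term into the integral of `φ`. This
identity replaces any appeal to uniqueness of minimizers. -/
theorem integral_norm_gradient_sub_sq {G : ℂ → ℂ}
    (hG : MemLp G 2 (volume.restrict (Ω : Set ℂ)))
    (hw : ∀ φ : 𝓓(Ω, ℝ), ∫ x in (Ω : Set ℂ), inner ℝ (G x) (∇ (φ : ℂ → ℝ) x) =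
      ∫ x in (Ω : Set ℂ), φ x) (φ : 𝓓(Ω, ℝ)) :
    ∫ x in (Ω : Set ℂ), ‖∇ (φ : ℂ → ℝ) x - G x‖ ^ 2 =
      torsionEnergy φ + ∫ x in (Ω : Set ℂ), ‖G x‖ ^ 2 := by
  have h1 : ∫ x in (Ω : Set ℂ), ‖∇ (φ : ℂ → ℝ) x‖ ^ 2 = ∫ x, ‖∇ (φ : ℂ → ℝ) x‖ ^ 2 :=
    setIntegral_eq_integral_of_forall_compl_eq_zero fun x hx => by
      simp [φ.gradient_eq_zero_of_notMem hx]
  have h2 : ∫ x in (Ω : Set ℂ), φ x = ∫ x, φ x :=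
    setIntegral_eq_integral_of_forall_compl_eq_zero fun x hx => φ.eq_zero_of_notMem hx
  have i1 := φ.integrable_sq_gradient.integrableOn (s := (Ω : Set ℂ))
  have i2 : Integrable (fun x => inner ℝ (G x) (∇ (φ : ℂ → ℝ) x))
      (volume.restrict (Ω : Set ℂ)) :=
    (hG.norm.integrable_mul (φ.memLp_gradient.restrict _).norm).mono'
      (hG.1.inner (φ.memLp_gradient.restrict _).1)
      (Eventually.of_forall fun x => norm_inner_le_norm _ _)
  have i3 := hG.norm.integrable_sq
  have : (fun x => ‖∇ (φ : ℂ → ℝ) x - G x‖ ^ 2) = fun x =>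
      (‖∇ (φ : ℂ → ℝ) x‖ ^ 2 - 2 * inner ℝ (G x) (∇ (φ : ℂ → ℝ) x)) + ‖G x‖ ^ 2 := by
    funext x
    rw [norm_sub_sq_real, real_inner_comm]
  have i12 : Integrable (fun x => ‖∇ (φ : ℂ → ℝ) x‖ ^ 2 - 2 * inner ℝ (G x) (∇ (φ : ℂ → ℝ) x))
      (volume.restrict (Ω : Set ℂ)) := i1.sub (i2.const_mul 2)
  rw [this, integral_add i12 i3, integral_sub i1 (i2.const_mul 2),
    integral_const_mul, hw, h1, h2, torsionEnergy]

theorem eLpNorm_two_sq {E : Type*} [NormedAddCommGroup E] {μ : Measure ℂ} {f : ℂ → E}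
    (hf : MemLp f 2 μ) : (eLpNorm f 2 μ).toReal ^ 2 = ∫ x, ‖f x‖ ^ 2 ∂μ := by
  rw [hf.eLpNorm_eq_integral_rpow_norm (by simp) (by simp), ENNReal.toReal_ofReal (by positivity)]
  simp only [ENNReal.toReal_ofNat, Real.rpow_ofNat]
  rw [← one_div, ← Real.sqrt_eq_rpow, Real.sq_sqrt (by positivity)]

theorem tendsto_eLpNorm_two_iff {E : Type*} [NormedAddCommGroup E] {μ : Measure ℂ}
    {f : ℕ → ℂ → E} (hf : ∀ n, MemLp (f n) 2 μ) :
    Tendsto (fun n => eLpNorm (f n) 2 μ) atTop (𝓝 0) ↔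
      Tendsto (fun n => ∫ x, ‖f n x‖ ^ 2 ∂μ) atTop (𝓝 0) := by
  simp_rw [← fun n => eLpNorm_two_sq (hf n)]
  rw [← ENNReal.tendsto_toReal_iff (fun n => (hf n).eLpNorm_ne_top) ENNReal.zero_ne_top,
    ENNReal.toReal_zero]
  constructor
  · intro h
    simpa using h.pow 2
  · intro h
    have := (Real.continuous_sqrt.tendsto 0).comp h
    simpa [Function.comp_def, Real.sqrt_sq] using this

/-- The Poincaré inequality for test functions in a bounded planar open set. -/
theorem exists_eLpNorm_le_eLpNorm_gradient (hΩ : Bornology.IsBounded (Ω : Set ℂ)) :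
    ∃ c : ENNReal, c ≠ ⊤ ∧ ∀ φ : 𝓓(Ω, ℝ), eLpNorm φ 2 volume ≤
      c * eLpNorm (∇ (φ : ℂ → ℝ)) 2 (volume.restrict (Ω : Set ℂ)) := by
  set k : NNReal := eLpNormLESNormFDerivOneConst (volume : Measure ℂ) 2
  refine ⟨k * (volume (Ω : Set ℂ)) ^ (1 / 2 : ℝ), ?_, fun φ => ?_⟩
  · exact ENNReal.mul_ne_top ENNReal.coe_ne_top
      (ENNReal.rpow_ne_top_of_nonneg (by norm_num) hΩ.measure_lt_top.ne)
  -- Sobolev's inequality with exponent one: in dimension two the conjugate exponent is `2`. Hölder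
  -- on the bounded set then passes from the `L¹` to the `L²` norm of the gradient.
  have h1 : eLpNorm φ (2 : NNReal) (volume : Measure ℂ) ≤ k * eLpNorm (fderiv ℝ φ) 1 volume :=
    eLpNorm_le_eLpNorm_fderiv_one volume (φ.contDiff.of_le (by simp)) φ.hasCompactSupport
      (by rw [Complex.finrank_real_complex]; exact_mod_cast NNReal.HolderConjugate.two_two)
  have h2 : eLpNorm (fderiv ℝ φ) 1 volume =
      eLpNorm (∇ (φ : ℂ → ℝ)) 1 (volume.restrict (Ω : Set ℂ)) := by
    rw [eLpNorm_congr_norm_ae (g := ∇ (φ : ℂ → ℝ))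
      (Eventually.of_forall fun x => (norm_gradient_eq _ x).symm),
      eLpNorm_restrict_eq_of_support_subset]
    exact fun x hx => by_contra fun h => hx (φ.gradient_eq_zero_of_notMem h)
  have h3 := eLpNorm_le_eLpNorm_mul_rpow_measure_univ (p := 1) (q := 2) (by norm_num)
    (φ.memLp_gradient.restrict (Ω : Set ℂ)).1
  calc eLpNorm φ 2 volume ≤ k * eLpNorm (∇ (φ : ℂ → ℝ)) 1 (volume.restrict (Ω : Set ℂ)) := by
        rw [← h2]; exact_mod_cast h1
    _ ≤ k * (eLpNorm (∇ (φ : ℂ → ℝ)) 2 (volume.restrict (Ω : Set ℂ)) *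
        volume (Ω : Set ℂ) ^ (1 / 2 : ℝ)) := by
        gcongr
        refine h3.trans_eq ?_
        rw [Measure.restrict_apply_univ]
        norm_num
    _ = _ := by ring

/-- Stability of minimizing sequences: the energy identity gives convergence of the gradients of `ψ
n`, and the Poincaré inequality for `ψ n - φ n` does the rest. -/
theorem tendsto_of_torsionEnergy_le (hΩ : Bornology.IsBounded (Ω : Set ℂ)) {G : ℂ → ℂ}
    (hG : MemLp G 2 (volume.restrict (Ω : Set ℂ)))
    (hw : ∀ φ : 𝓓(Ω, ℝ), ∫ x in (Ω : Set ℂ), inner ℝ (G x) (∇ (φ : ℂ → ℝ) x) =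
      ∫ x in (Ω : Set ℂ), φ x) {φ ψ : ℕ → 𝓓(Ω, ℝ)} {δ : ℕ → ℝ} (hδ : Tendsto δ atTop (𝓝 0))
    (hle : ∀ n, torsionEnergy (ψ n) ≤ torsionEnergy (φ n) + δ n)
    (hφ : Tendsto (fun n => eLpNorm (fun x => ∇ (φ n : ℂ → ℝ) x - G x) 2
      (volume.restrict (Ω : Set ℂ))) atTop (𝓝 0)) :
    Tendsto (fun n => eLpNorm (fun x => ∇ (ψ n : ℂ → ℝ) x - G x) 2
      (volume.restrict (Ω : Set ℂ))) atTop (𝓝 0) ∧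
    Tendsto (fun n => eLpNorm (fun x => ψ n x - φ n x) 2 volume) atTop (𝓝 0) := by
  have hm : ∀ χ : 𝓓(Ω, ℝ), MemLp (fun x => ∇ (χ : ℂ → ℝ) x - G x) 2
      (volume.restrict (Ω : Set ℂ)) := fun χ => (χ.memLp_gradient.restrict _).sub hG
  have h1 : Tendsto (fun n => eLpNorm (fun x => ∇ (ψ n : ℂ → ℝ) x - G x) 2
      (volume.restrict (Ω : Set ℂ))) atTop (𝓝 0) := by
    rw [tendsto_eLpNorm_two_iff fun n => hm _] at hφ ⊢
    refine squeeze_zero (fun n => by positivity) (fun n => ?_) (by simpa using hφ.add hδ)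
    rw [integral_norm_gradient_sub_sq hG hw, integral_norm_gradient_sub_sq hG hw]
    linarith [hle n]
  refine ⟨h1, ?_⟩
  obtain ⟨c, hc, hP⟩ := exists_eLpNorm_le_eLpNorm_gradient hΩ
  have h2 : Tendsto (fun n => c * (eLpNorm (fun x => ∇ (ψ n : ℂ → ℝ) x - G x) 2
      (volume.restrict (Ω : Set ℂ)) + eLpNorm (fun x => ∇ (φ n : ℂ → ℝ) x - G x) 2
      (volume.restrict (Ω : Set ℂ)))) atTop (𝓝 0) := by
    have := ENNReal.Tendsto.const_mul (h1.add hφ) (Or.inr hc)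
    simpa using this
  refine tendsto_of_tendsto_of_tendsto_of_le_of_le tendsto_const_nhds h2 (fun _ => bot_le)
    fun n => ?_
  refine (hP (ψ n - φ n)).trans ?_
  gcongr
  refine le_of_eq_of_le ?_ (eLpNorm_sub_le (hm (ψ n)).1 (hm (φ n)).1 (by norm_num))
  congr 1
  funext x
  have e : ((ψ n - φ n : 𝓓(Ω, ℝ)) : ℂ → ℝ) = fun y => ψ n y - φ n y := rfl
  have d := fun χ : 𝓓(Ω, ℝ) => (χ.contDiff.differentiable (by simp)).differentiableAt (x := x)
  rw [e]
  simp [gradient, fderiv_fun_sub (d _) (d _)]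

end Energy

/-! ### Nonnegativity of the torsion function -/

section Positivity

variable {Ω : TopologicalSpace.Opens ℂ}

/-- The composition of a test function with a smooth ramp. -/
noncomputable def TestFunction.ramp (φ : 𝓓(Ω, ℝ)) {ε : ℝ} (hε : 0 < ε) : 𝓓(Ω, ℝ) where
  toFun := smoothRamp ε ∘ φ
  contDiff' := (contDiff_smoothRamp ε).comp φ.contDiff
  hasCompactSupport' := φ.hasCompactSupport.comp_left (smoothRamp_of_le hε hε.le)
  tsupport_subset' := (tsupport_comp_subset (smoothRamp_of_le hε hε.le) _).trans φ.tsupport_subset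

theorem TestFunction.differentiableAt (φ : 𝓓(Ω, ℝ)) (x : ℂ) : DifferentiableAt ℝ φ x :=
  (φ.contDiff.differentiable (by simp)).differentiableAt

/-- The slope of the ramp is in `[0, 1]`, so gradients do not grow; values drop by at most `2 * ε`,
and the energy counts the integral twice. -/
theorem torsionEnergy_ramp_le (hΩ : Bornology.IsBounded (Ω : Set ℂ)) (φ : 𝓓(Ω, ℝ)) {ε : ℝ}
    (hε : 0 < ε) :
    torsionEnergy (φ.ramp hε) ≤ torsionEnergy φ + ε * (4 * volume.real (Ω : Set ℂ)) := by
  have h1 : ∫ x, ‖∇ (φ.ramp hε : ℂ → ℝ) x‖ ^ 2 ≤ ∫ x, ‖∇ (φ : ℂ → ℝ) x‖ ^ 2 := by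
    refine integral_mono (φ.ramp hε).integrable_sq_gradient φ.integrable_sq_gradient fun x => ?_
    have : fderiv ℝ (φ.ramp hε : ℂ → ℝ) x =
        Real.smoothTransition (φ x / ε - 1) • fderiv ℝ φ x :=
      ((hasDerivAt_smoothRamp ε (φ x)).comp_hasFDerivAt x (φ.differentiableAt x).hasFDerivAt).fderiv
    simp only [norm_gradient_eq]
    rw [this, norm_smul, Real.norm_of_nonneg (Real.smoothTransition.nonneg _)]
    refine pow_le_pow_left₀ (mul_nonneg (Real.smoothTransition.nonneg _) (norm_nonneg _)) ?_ 2
    exact mul_le_of_le_one_left (norm_nonneg _) (Real.smoothTransition.le_one _)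
  have e : ∀ χ : 𝓓(Ω, ℝ), ∫ x in (Ω : Set ℂ), χ x = ∫ x, χ x := fun χ =>
    setIntegral_eq_integral_of_forall_compl_eq_zero fun x hx => χ.eq_zero_of_notMem hx
  have i : ∀ χ : 𝓓(Ω, ℝ), Integrable χ (volume.restrict (Ω : Set ℂ)) := fun χ =>
    (χ.continuous.integrable_of_hasCompactSupport χ.hasCompactSupport).restrict
  have hf : IsFiniteMeasure (volume.restrict (Ω : Set ℂ)) :=
    ⟨by rw [Measure.restrict_apply_univ]; exact hΩ.measure_lt_top⟩
  have h2 : (∫ x, φ x) - 2 * ε * volume.real (Ω : Set ℂ) ≤ ∫ x, φ.ramp hε x := by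
    have hc : ∫ x in (Ω : Set ℂ), (2 * ε) = 2 * ε * volume.real (Ω : Set ℂ) := by
      rw [setIntegral_const, smul_eq_mul, mul_comm]
    rw [← e, ← e, ← hc, ← integral_sub (i φ) (integrable_const _)]
    exact integral_mono ((i φ).sub (integrable_const _)) (i _) fun x => sub_le_smoothRamp hε _
  unfold torsionEnergy
  linarith

/-- An element of `H¹₀(Ω)` which solves the torsion problem is a limit of nonnegative test
functions. -/
theorem MemH10.exists_nonneg_approx (hΩ : Bornology.IsBounded (Ω : Set ℂ)) {u : ℂ → ℝ} {G : ℂ → ℂ}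
    (hu : MemH10 Ω u G)
    (hw : ∀ φ : 𝓓(Ω, ℝ), ∫ x in (Ω : Set ℂ), inner ℝ (G x) (∇ (φ : ℂ → ℝ) x) =
      ∫ x in (Ω : Set ℂ), φ x) :
    ∃ φ : ℕ → 𝓓(Ω, ℝ), (∀ n x, 0 ≤ φ n x) ∧
      Tendsto (fun n => eLpNorm (fun x => φ n x - u x) 2 (volume.restrict (Ω : Set ℂ)))
        atTop (𝓝 0) ∧
      Tendsto (fun n => eLpNorm (fun x => ∇ (φ n : ℂ → ℝ) x - G x) 2
        (volume.restrict (Ω : Set ℂ))) atTop (𝓝 0) := by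
  obtain ⟨φ, hφu, hφG⟩ := hu.exists_approx
  have hδ : ∀ n : ℕ, (0 : ℝ) < 1 / ((n : ℝ) + 1) := fun n => by positivity
  have hδ0 : Tendsto (fun n : ℕ => 1 / ((n : ℝ) + 1) * (4 * volume.real (Ω : Set ℂ)))
      atTop (𝓝 0) := by
    simpa using tendsto_one_div_add_atTop_nhds_zero_nat.mul_const (4 * volume.real (Ω : Set ℂ))
  obtain ⟨h1, h2⟩ := tendsto_of_torsionEnergy_le hΩ hu.memLp_grad hw
    (ψ := fun n => (φ n).ramp (hδ n)) hδ0 (fun n => torsionEnergy_ramp_le hΩ (φ n) (hδ n)) hφG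
  refine ⟨fun n => (φ n).ramp (hδ n), fun n x => smoothRamp_nonneg (hδ n) _, ?_, h1⟩
  have h3 := h2.add hφu
  rw [add_zero] at h3
  refine tendsto_of_tendsto_of_tendsto_of_le_of_le tendsto_const_nhds h3 (fun _ => bot_le)
    fun n => ?_
  calc eLpNorm (fun x => (φ n).ramp (hδ n) x - u x) 2 (volume.restrict (Ω : Set ℂ))
      = eLpNorm ((fun x => (φ n).ramp (hδ n) x - φ n x) + fun x => φ n x - u x) 2
          (volume.restrict (Ω : Set ℂ)) := by
        congr 1; funext x; simp
    _ ≤ eLpNorm (fun x => (φ n).ramp (hδ n) x - φ n x) 2 (volume.restrict (Ω : Set ℂ)) +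
        eLpNorm (fun x => φ n x - u x) 2 (volume.restrict (Ω : Set ℂ)) :=
        eLpNorm_add_le
          ((((φ n).ramp (hδ n)).memLp.sub (φ n).memLp).restrict _).1
          (((φ n).memLp.restrict _).sub hu.memLp).1 (by norm_num)
    _ ≤ _ := add_le_add_left (eLpNorm_restrict_le _ 2 volume (Ω : Set ℂ)) _

theorem nonpos_of_ae_le_zero {U : Set ℂ} (hU : IsOpen U) {f : ℂ → ℝ} (hf : ContinuousOn f U)
    (h : ∀ᵐ x ∂volume.restrict U, f x ≤ 0) : ∀ x ∈ U, f x ≤ 0 := by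
  intro x hx
  by_contra! hlt
  have ho : IsOpen (U ∩ f ⁻¹' Set.Ioi 0) := hf.isOpen_inter_preimage hU isOpen_Ioi
  rw [ae_restrict_iff' hU.measurableSet] at h
  have : volume (U ∩ f ⁻¹' Set.Ioi 0) = 0 := by
    refine measure_mono_null (fun y hy => ?_) (mem_ae_iff.1 h)
    exact fun hc => absurd (hc hy.1) (not_le.2 hy.2)
  exact (ho.measure_pos volume ⟨x, hx, hlt⟩).ne' this

theorem ae_nonpos_of_forall_eLpNorm_le {μ : Measure ℂ} {f : ℂ → ℝ} (hf : AEStronglyMeasurable f μ)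
    {b : ℕ → ENNReal} (hb : Tendsto b atTop (𝓝 0))
    (h : ∀ n, eLpNorm (fun x => max (f x) 0) 2 μ ≤ b n) : ∀ᵐ x ∂μ, f x ≤ 0 := by
  have h0 : eLpNorm (fun x => max (f x) 0) 2 μ = 0 :=
    le_antisymm (ge_of_tendsto' hb h) bot_le
  have hm : AEStronglyMeasurable (fun x => max (f x) 0) μ := hf.sup aestronglyMeasurable_const
  filter_upwards [(eLpNorm_eq_zero_iff hm (by norm_num)).1 h0] with x hx
  exact max_eq_right_iff.1 hx

/-- The torsion function is nonnegative in the interior. -/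
theorem IsWeakTorsionSolution.nonneg (hΩ : Bornology.IsBounded (Ω : Set ℂ)) {u : ℂ → ℝ}
    (hu : IsWeakTorsionSolution Ω u) (hc : ContinuousOn u (Ω : Set ℂ)) :
    ∀ x ∈ (Ω : Set ℂ), 0 ≤ u x := by
  obtain ⟨G, hG, hw⟩ := hu
  obtain ⟨φ, hφ, hφu, -⟩ := hG.exists_nonneg_approx hΩ hw
  have h : ∀ᵐ x ∂volume.restrict (Ω : Set ℂ), -u x ≤ 0 := by
    refine ae_nonpos_of_forall_eLpNorm_le hG.memLp.1.neg hφu fun n =>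
      eLpNorm_mono fun x => ?_
    rw [Real.norm_of_nonneg (le_max_right _ _), Real.norm_eq_abs]
    exact max_le ((by linarith [hφ n x] : -u x ≤ φ n x - u x).trans (le_abs_self _))
      (abs_nonneg _)
  intro x hx
  exact neg_nonpos.1 (nonpos_of_ae_le_zero Ω.isOpen hc.neg h x hx)

end Positivity

/-! ### Polarization with respect to a line -/

/-- `σ` is the reflection of the plane across the line `{h = 0}`, and it exchanges the sides
`{h < 0}` and `{0 < h}` of the line. -/
structure IsLineReflection (σ : ℂ → ℂ) (h : ℂ → ℝ) : Prop where
  contDiff : ContDiff ℝ (⊤ : ℕ∞) σ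
  exists_hasFDerivAt : ∃ S : ℂ ≃ₗᵢ[ℝ] ℂ, ∀ x, HasFDerivAt σ ((S : ℂ ≃L[ℝ] ℂ) : ℂ →L[ℝ] ℂ) x
  measurePreserving : MeasurePreserving σ volume volume
  involutive : Function.Involutive σ
  continuous_side : Continuous h
  side_apply : ∀ x, h (σ x) = -h x
  fixed : ∀ x, h x = 0 → σ x = x

section Polarization

variable {Ω : TopologicalSpace.Opens ℂ} {σ : ℂ → ℂ} {h : ℂ → ℝ}

/-- A line reflection as a homeomorphism. -/
def IsLineReflection.toHomeomorph (hσ : IsLineReflection σ h) : ℂ ≃ₜ ℂ where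
  toEquiv := hσ.involutive.toPerm
  continuous_toFun := hσ.contDiff.continuous
  continuous_invFun := hσ.contDiff.continuous

theorem IsLineReflection.measurableEmbedding (hσ : IsLineReflection σ h) :
    MeasurableEmbedding σ :=
  hσ.toHomeomorph.measurableEmbedding

theorem IsLineReflection.integral_comp (hσ : IsLineReflection σ h) (f : ℂ → ℝ) :
    ∫ x, f (σ x) = ∫ x, f x :=
  hσ.measurePreserving.integral_comp hσ.measurableEmbedding f

theorem IsLineReflection.integrable_comp (hσ : IsLineReflection σ h) {f : ℂ → ℝ}
    (hf : Integrable f) : Integrable fun x => f (σ x) :=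
  hσ.measurePreserving.integrable_comp_of_integrable hf

/-- The amount which the smooth polarization of `φ` transfers from the side `{h < 0}` to the
other one. -/
noncomputable def polarTransfer (σ : ℂ → ℂ) (h : ℂ → ℝ) (ε : ℝ) (φ : ℂ → ℝ) (x : ℂ) : ℝ :=
  if h x < 0 then smoothRamp ε (φ x - φ (σ x)) else 0

theorem polarTransfer_eventuallyEq (hσ : IsLineReflection σ h) (ε : ℝ) (φ : ℂ → ℝ) {x : ℂ}
    (hx : h x < 0) :
    polarTransfer σ h ε φ =ᶠ[𝓝 x] fun y => smoothRamp ε (φ y - φ (σ y)) := by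
  filter_upwards [hσ.continuous_side.continuousAt.eventually_lt_const hx] with y hy
  rw [polarTransfer, if_pos hy]

/-- On the line `φ - φ ∘ σ` vanishes, so it is below `ε` nearby, where the ramp is zero. Hence
cutting off along the line does not spoil smoothness. -/
theorem polarTransfer_eventuallyEq_zero (hσ : IsLineReflection σ h) {ε : ℝ} (hε : 0 < ε)
    {φ : ℂ → ℝ} (hφ : Continuous φ) {x : ℂ} (hx : 0 ≤ h x) :
    polarTransfer σ h ε φ =ᶠ[𝓝 x] fun _ => 0 := by
  rcases hx.lt_or_eq with hx | hx
  · filter_upwards [hσ.continuous_side.continuousAt.eventually_const_lt hx] with y hy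
    rw [polarTransfer, if_neg hy.not_gt]
  · have hc : ContinuousAt (fun y => φ y - φ (σ y)) x :=
      (hφ.sub (hφ.comp hσ.contDiff.continuous)).continuousAt
    have h0 : φ x - φ (σ x) < ε := by rw [hσ.fixed x hx.symm, sub_self]; exact hε
    filter_upwards [hc.eventually_lt_const h0] with y hy
    rw [polarTransfer]
    split_ifs
    · exact smoothRamp_of_le hε hy.le
    · rfl

theorem contDiff_polarTransfer (hσ : IsLineReflection σ h) {ε : ℝ} (hε : 0 < ε)
    {φ : ℂ → ℝ} (hφ : ContDiff ℝ (⊤ : ℕ∞) φ) : ContDiff ℝ (⊤ : ℕ∞) (polarTransfer σ h ε φ) := by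
  rw [contDiff_iff_contDiffAt]
  intro x
  rcases lt_or_ge (h x) 0 with hx | hx
  · refine ContDiffAt.congr_of_eventuallyEq ?_ (polarTransfer_eventuallyEq hσ ε φ hx)
    exact ((contDiff_smoothRamp ε).comp (hφ.sub (hφ.comp hσ.contDiff))).contDiffAt
  · exact contDiffAt_const.congr_of_eventuallyEq
      (polarTransfer_eventuallyEq_zero hσ hε hφ.continuous hx)

/-- The smooth polarization of `φ` with respect to the line `{h = 0}`. -/
noncomputable def polarize (σ : ℂ → ℂ) (h : ℂ → ℝ) (ε : ℝ) (φ : ℂ → ℝ) (x : ℂ) : ℝ :=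
  φ x - polarTransfer σ h ε φ x + polarTransfer σ h ε φ (σ x)

theorem contDiff_polarize (hσ : IsLineReflection σ h) {ε : ℝ} (hε : 0 < ε)
    {φ : ℂ → ℝ} (hφ : ContDiff ℝ (⊤ : ℕ∞) φ) : ContDiff ℝ (⊤ : ℕ∞) (polarize σ h ε φ) :=
  (hφ.sub (contDiff_polarTransfer hσ hε hφ)).add
    ((contDiff_polarTransfer hσ hε hφ).comp hσ.contDiff)

/-- The threshold `ε ≤ φ x - φ (σ x)` is a closed condition, hence survives the closure; with `φ ≥
0` it forces `φ x > 0`, and it fails on the line. -/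
theorem tsupport_polarTransfer_subset (hσ : IsLineReflection σ h) {ε : ℝ} (hε : 0 < ε)
    {φ : ℂ → ℝ} (hφ : Continuous φ) (h0 : ∀ x, 0 ≤ φ x) :
    tsupport (polarTransfer σ h ε φ) ⊆ {x | φ x ≠ 0} ∩ {x | h x < 0} := by
  have hcl : IsClosed ({x | h x ≤ 0} ∩ {x | ε ≤ φ x - φ (σ x)}) :=
    (isClosed_le hσ.continuous_side continuous_const).inter
      (isClosed_le continuous_const (hφ.sub (hφ.comp hσ.contDiff.continuous)))
  have hsub : tsupport (polarTransfer σ h ε φ) ⊆ {x | h x ≤ 0} ∩ {x | ε ≤ φ x - φ (σ x)} := by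
    refine closure_minimal (fun x hx => ?_) hcl
    rw [Function.mem_support, polarTransfer] at hx
    split_ifs at hx with hh
    · exact ⟨hh.le, by_contra fun hlt => hx (smoothRamp_of_le hε (not_le.1 hlt).le)⟩
    · exact absurd rfl hx
  intro x hx
  obtain ⟨h1, h2⟩ := hsub hx
  change h x ≤ 0 at h1
  change ε ≤ φ x - φ (σ x) at h2
  refine ⟨?_, h1.lt_of_ne fun he => ?_⟩
  · have := h0 (σ x)
    exact (by linarith : 0 < φ x).ne'
  · rw [hσ.fixed x he] at h2
    linarith

/-- The smooth polarization of a nonnegative test function. -/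
noncomputable def TestFunction.polarize (hσ : IsLineReflection σ h)
    (hΩ : ∀ x ∈ (Ω : Set ℂ), h x < 0 → σ x ∈ (Ω : Set ℂ)) {ε : ℝ} (hε : 0 < ε)
    (φ : 𝓓(Ω, ℝ)) (h0 : ∀ x, 0 ≤ φ x) : 𝓓(Ω, ℝ) :=
  have hs := tsupport_polarTransfer_subset hσ hε φ.continuous h0
  have hT : tsupport (polarTransfer σ h ε φ) ⊆ (Ω : Set ℂ) := fun x hx =>
    by_contra fun hn => (hs hx).1 (φ.eq_zero_of_notMem hn)
  have hTσ : tsupport (polarTransfer σ h ε φ ∘ σ) ⊆ σ ⁻¹' tsupport (polarTransfer σ h ε φ) :=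
    tsupport_comp_subset_preimage _ hσ.contDiff.continuous
  have hσT : tsupport (polarTransfer σ h ε φ ∘ σ) ⊆ (Ω : Set ℂ) := fun x hx => by
    have := hΩ _ (hT (hTσ hx)) (hs (hTσ hx)).2
    rwa [hσ.involutive x] at this
  have hc : HasCompactSupport (polarTransfer σ h ε φ) :=
    φ.hasCompactSupport.of_isClosed_subset (isClosed_tsupport _)
      fun x hx => subset_tsupport _ (hs hx).1
  { toFun := _root_.polarize σ h ε φ
    contDiff' := contDiff_polarize hσ hε φ.contDiff
    hasCompactSupport' := (φ.hasCompactSupport.sub hc).add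
      (hc.comp_homeomorph hσ.toHomeomorph)
    tsupport_subset' := (tsupport_add _ _).trans <| Set.union_subset
      ((tsupport_sub _ _).trans <| Set.union_subset φ.tsupport_subset hT) hσT }

theorem TestFunction.polarize_apply (hσ : IsLineReflection σ h)
    (hΩ : ∀ x ∈ (Ω : Set ℂ), h x < 0 → σ x ∈ (Ω : Set ℂ)) {ε : ℝ} (hε : 0 < ε)
    (φ : 𝓓(Ω, ℝ)) (h0 : ∀ x, 0 ≤ φ x) (x : ℂ) :
    φ.polarize hσ hΩ hε h0 x =
      φ x - polarTransfer σ h ε φ x + polarTransfer σ h ε φ (σ x) := rfl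

/-- The two new vectors are convex combinations of `a` and `b` with exchanged weights, and the
squared norm is convex. -/
theorem norm_sq_convex_swap_le {E : Type*} [NormedAddCommGroup E] [NormedSpace ℝ E] (a b : E)
    {θ : ℝ} (h0 : 0 ≤ θ) (h1 : θ ≤ 1) :
    ‖a - θ • (a - b)‖ ^ 2 + ‖b + θ • (a - b)‖ ^ 2 ≤ ‖a‖ ^ 2 + ‖b‖ ^ 2 := by
  have key : ∀ c d : E, ‖(1 - θ) • c + θ • d‖ ^ 2 ≤ (1 - θ) * ‖c‖ ^ 2 + θ * ‖d‖ ^ 2 := by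
    intro c d
    have h2 : ‖(1 - θ) • c + θ • d‖ ≤ (1 - θ) * ‖c‖ + θ * ‖d‖ := by
      refine (norm_add_le _ _).trans_eq ?_
      rw [norm_smul, norm_smul, Real.norm_of_nonneg h0, Real.norm_of_nonneg (sub_nonneg.2 h1)]
    have h3 : ‖(1 - θ) • c + θ • d‖ ^ 2 ≤ ((1 - θ) * ‖c‖ + θ * ‖d‖) ^ 2 := by gcongr
    nlinarith [mul_nonneg (mul_nonneg h0 (sub_nonneg.2 h1)) (sq_nonneg (‖c‖ - ‖d‖))]
  have e1 : a - θ • (a - b) = (1 - θ) • a + θ • b := by module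
  have e2 : b + θ • (a - b) = (1 - θ) • b + θ • a := by module
  rw [e1, e2]
  linarith [key a b, key b a]

theorem IsLineReflection.norm_gradient_comp (hσ : IsLineReflection σ h) {f : ℂ → ℝ}
    (hf : ContDiff ℝ (⊤ : ℕ∞) f) (x : ℂ) : ‖∇ f (σ x)‖ = ‖fderiv ℝ (f ∘ σ) x‖ := by
  obtain ⟨S, hS⟩ := hσ.exists_hasFDerivAt
  rw [norm_gradient_eq,
    (((hf.differentiable (by simp)).differentiableAt.hasFDerivAt).comp x (hS x)).fderiv]
  exact (ContinuousLinearMap.opNorm_comp_linearIsometryEquiv _ S).symm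

/-- Near `x` the pair `(φ, φ ∘ σ)` becomes `(φ - η, φ ∘ σ + η)` with `η` the ramp of the difference.
The derivative of `η` is `θ` times the difference of the derivatives, `θ ∈ [0, 1]`, so
`norm_sq_convex_swap_le` applies. -/
theorem norm_sq_gradient_polarize_add_le_of_neg (hσ : IsLineReflection σ h) {ε : ℝ} (hε : 0 < ε)
    {φ : ℂ → ℝ} (hφ : ContDiff ℝ (⊤ : ℕ∞) φ) {x : ℂ} (hx : h x < 0) :
    ‖∇ (polarize σ h ε φ) x‖ ^ 2 + ‖∇ (polarize σ h ε φ) (σ x)‖ ^ 2 ≤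
      ‖∇ φ x‖ ^ 2 + ‖∇ φ (σ x)‖ ^ 2 := by
  have d1 : HasFDerivAt φ (fderiv ℝ φ x) x :=
    (hφ.differentiable (by simp)).differentiableAt.hasFDerivAt
  have d2 : HasFDerivAt (φ ∘ σ) (fderiv ℝ (φ ∘ σ) x) x :=
    ((hφ.comp hσ.contDiff).differentiable (by simp)).differentiableAt.hasFDerivAt
  have dη : HasFDerivAt (fun y => smoothRamp ε (φ y - φ (σ y)))
      (Real.smoothTransition ((φ x - φ (σ x)) / ε - 1) •
        (fderiv ℝ φ x - fderiv ℝ (φ ∘ σ) x)) x :=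
    HasDerivAt.comp_hasFDerivAt (f := fun y => φ y - φ (σ y)) x
      (hasDerivAt_smoothRamp ε (φ x - φ (σ x))) (d1.fun_sub d2)
  have e1 := polarTransfer_eventuallyEq hσ ε φ hx
  have hx' : 0 ≤ h (σ x) := by rw [hσ.side_apply]; linarith
  have e2 : ∀ᶠ y in 𝓝 x, polarTransfer σ h ε φ (σ y) = 0 :=
    hσ.contDiff.continuous.continuousAt.eventually
      (polarTransfer_eventuallyEq_zero hσ hε hφ.continuous hx')
  have w1 : polarize σ h ε φ =ᶠ[𝓝 x] fun y => φ y - smoothRamp ε (φ y - φ (σ y)) := by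
    filter_upwards [e1, e2] with y h1 h2
    rw [polarize, h1, h2, add_zero]
  have w2 : polarize σ h ε φ ∘ σ =ᶠ[𝓝 x]
      fun y => (φ ∘ σ) y + smoothRamp ε (φ y - φ (σ y)) := by
    filter_upwards [e1, e2] with y h1 h2
    rw [Function.comp_apply, polarize, hσ.involutive y, h1, h2, sub_zero, Function.comp_apply]
  rw [hσ.norm_gradient_comp (contDiff_polarize hσ hε hφ), hσ.norm_gradient_comp hφ,
    norm_gradient_eq, norm_gradient_eq, w1.fderiv_eq, w2.fderiv_eq, (d1.fun_sub dη).fderiv,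
    (d2.fun_add dη).fderiv]
  exact norm_sq_convex_swap_le _ _ (Real.smoothTransition.nonneg _) (Real.smoothTransition.le_one _)

theorem norm_sq_gradient_polarize_add_le (hσ : IsLineReflection σ h) {ε : ℝ} (hε : 0 < ε)
    {φ : ℂ → ℝ} (hφ : ContDiff ℝ (⊤ : ℕ∞) φ) (x : ℂ) :
    ‖∇ (polarize σ h ε φ) x‖ ^ 2 + ‖∇ (polarize σ h ε φ) (σ x)‖ ^ 2 ≤
      ‖∇ φ x‖ ^ 2 + ‖∇ φ (σ x)‖ ^ 2 := by
  rcases lt_trichotomy (h x) 0 with hx | hx | hx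
  · exact norm_sq_gradient_polarize_add_le_of_neg hσ hε hφ hx
  · have e1 := polarTransfer_eventuallyEq_zero hσ hε hφ.continuous hx.ge
    have e2 : ∀ᶠ y in 𝓝 x, polarTransfer σ h ε φ (σ y) = 0 := by
      have hc := hσ.contDiff.continuous.tendsto x
      rw [hσ.fixed x hx] at hc
      exact hc.eventually e1
    have w : polarize σ h ε φ =ᶠ[𝓝 x] φ := by
      filter_upwards [e1, e2] with y h1 h2
      rw [polarize, h1, h2, sub_zero, add_zero]
    rw [hσ.fixed x hx, w.gradient_eq]
  · have := norm_sq_gradient_polarize_add_le_of_neg hσ hε hφ (x := σ x)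
      (by rw [hσ.side_apply]; linarith)
    rw [hσ.involutive x] at this
    linarith

/-- Polarization does not increase the energy. -/
theorem torsionEnergy_polarize_le (hσ : IsLineReflection σ h)
    (hΩ : ∀ x ∈ (Ω : Set ℂ), h x < 0 → σ x ∈ (Ω : Set ℂ)) {ε : ℝ} (hε : 0 < ε)
    (φ : 𝓓(Ω, ℝ)) (h0 : ∀ x, 0 ≤ φ x) :
    torsionEnergy (φ.polarize hσ hΩ hε h0) ≤ torsionEnergy φ := by
  set ψ := φ.polarize hσ hΩ hε h0
  have hs : ∀ χ : 𝓓(Ω, ℝ), ∫ x, ‖∇ (χ : ℂ → ℝ) x‖ ^ 2 + ‖∇ (χ : ℂ → ℝ) (σ x)‖ ^ 2 =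
      2 * ∫ x, ‖∇ (χ : ℂ → ℝ) x‖ ^ 2 := fun χ => by
    rw [integral_add χ.integrable_sq_gradient (hσ.integrable_comp χ.integrable_sq_gradient),
      hσ.integral_comp fun y => ‖∇ (χ : ℂ → ℝ) y‖ ^ 2, two_mul]
  have hi : ∀ χ : 𝓓(Ω, ℝ),
      Integrable fun x => ‖∇ (χ : ℂ → ℝ) x‖ ^ 2 + ‖∇ (χ : ℂ → ℝ) (σ x)‖ ^ 2 := fun χ =>
    χ.integrable_sq_gradient.add (hσ.integrable_comp χ.integrable_sq_gradient)
  have h1 := integral_mono (hi ψ) (hi φ)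
    fun x => norm_sq_gradient_polarize_add_le hσ hε φ.contDiff x
  rw [hs, hs] at h1
  have iχ : ∀ χ : 𝓓(Ω, ℝ), Integrable χ (volume : Measure ℂ) := fun χ =>
    χ.continuous.integrable_of_hasCompactSupport χ.hasCompactSupport
  have h2 : ∫ x, ψ x = ∫ x, φ x := by
    have hp : ∀ χ : 𝓓(Ω, ℝ), ∫ x, χ x + χ (σ x) = 2 * ∫ x, χ x := fun χ => by
      rw [integral_add (iχ χ) (hσ.integrable_comp (iχ χ)), hσ.integral_comp χ, two_mul]
    have : ∀ x, ψ x + ψ (σ x) = φ x + φ (σ x) := fun x => by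
      simp only [ψ, TestFunction.polarize_apply, hσ.involutive x]
      ring
    have := hp ψ
    simp_rw [‹∀ x, ψ x + ψ (σ x) = φ x + φ (σ x)›, hp φ] at this
    linarith
  unfold torsionEnergy
  linarith

/-- Comparison of the torsion function with its reflection: if the reflection maps the part of
`Ω` on one side of a line into `Ω`, then the torsion function is smaller on that side. -/
theorem IsWeakTorsionSolution.le_comp_reflection (hσ : IsLineReflection σ h)
    (hb : Bornology.IsBounded (Ω : Set ℂ))
    (hΩ : ∀ x ∈ (Ω : Set ℂ), h x < 0 → σ x ∈ (Ω : Set ℂ)) {u : ℂ → ℝ}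
    (hu : IsWeakTorsionSolution Ω u) (hc : ContinuousOn u (Ω : Set ℂ)) :
    ∀ x ∈ (Ω : Set ℂ), h x < 0 → u x ≤ u (σ x) := by
  obtain ⟨G, hG, hw⟩ := hu
  obtain ⟨φ, hφ, hφu, hφG⟩ := hG.exists_nonneg_approx hb hw
  set U : Set ℂ := (Ω : Set ℂ) ∩ {x | h x < 0}
  have hUo : IsOpen U := Ω.isOpen.inter (isOpen_lt hσ.continuous_side continuous_const)
  have hUσ : U ⊆ σ ⁻¹' (Ω : Set ℂ) := fun x hx => hΩ x hx.1 hx.2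
  have hcσ : ContinuousOn (fun x => u (σ x)) U :=
    hc.comp hσ.contDiff.continuous.continuousOn hUσ
  -- On `U` the polarization changes `φ n` by exactly the ramp of `φ n - φ n ∘ σ`, which dominates
  -- that difference minus `2 * ε`. This change and the errors `φ n - u` at `x` and `σ x` all tend
  -- to zero in `L²`.
  have main : ∀ ε : ℝ, 0 < ε → ∀ x ∈ U, u x - u (σ x) - 2 * ε ≤ 0 := by
    intro ε hε
    have hcu : ContinuousOn (fun x => u x - u (σ x) - 2 * ε) U :=
      ((hc.mono Set.inter_subset_left).sub hcσ).sub continuousOn_const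
    refine nonpos_of_ae_le_zero hUo hcu ?_
    obtain ⟨-, h2⟩ := tendsto_of_torsionEnergy_le hb hG.memLp_grad hw
      (ψ := fun n => (φ n).polarize hσ hΩ hε (hφ n)) (tendsto_const_nhds (x := (0 : ℝ)))
      (fun n => by rw [add_zero]; exact torsionEnergy_polarize_le hσ hΩ hε (φ n) (hφ n)) hφG
    refine ae_nonpos_of_forall_eLpNorm_le (hcu.aestronglyMeasurable hUo.measurableSet)
      (b := fun n => eLpNorm (fun x => φ n x - u x) 2 (volume.restrict (Ω : Set ℂ)) +
        eLpNorm (fun x => (φ n).polarize hσ hΩ hε (hφ n) x - φ n x) 2 volume +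
        eLpNorm (fun x => φ n x - u x) 2 (volume.restrict (Ω : Set ℂ)))
      (by simpa using (hφu.add h2).add hφu) fun n => ?_
    have hd : AEStronglyMeasurable (fun x => φ n x - u x) (volume.restrict (Ω : Set ℂ)) :=
      (((φ n).memLp.restrict _).sub hG.memLp).1
    have hmp : MeasurePreserving σ (volume.restrict (σ ⁻¹' (Ω : Set ℂ)))
        (volume.restrict (Ω : Set ℂ)) :=
      hσ.measurePreserving.restrict_preimage Ω.isOpen.measurableSet
    have hle : volume.restrict U ≤ volume.restrict (σ ⁻¹' (Ω : Set ℂ)) :=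
      Measure.restrict_mono hUσ le_rfl
    have hm1 := hd.mono_measure (Measure.restrict_mono (Set.inter_subset_left :
      U ⊆ (Ω : Set ℂ)) le_rfl)
    have hm2 : AEStronglyMeasurable
        (fun x => (φ n).polarize hσ hΩ hε (hφ n) x - φ n x) (volume.restrict U) :=
      ((((φ n).polarize hσ hΩ hε (hφ n)).memLp.sub (φ n).memLp).restrict U).1
    have hm3 : AEStronglyMeasurable (fun x => φ n (σ x) - u (σ x)) (volume.restrict U) :=
      (hd.comp_measurePreserving hmp).mono_measure hle
    have hcomp : eLpNorm (fun x => φ n (σ x) - u (σ x)) 2 (volume.restrict (σ ⁻¹' (Ω : Set ℂ))) =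
        eLpNorm (fun x => φ n x - u x) 2 (volume.restrict (Ω : Set ℂ)) := by
      have := eLpNorm_comp_measurePreserving (p := 2) hd hmp
      rwa [Function.comp_def] at this
    calc eLpNorm (fun x => max (u x - u (σ x) - 2 * ε) 0) 2 (volume.restrict U)
        ≤ eLpNorm (((fun x => ‖φ n x - u x‖) +
            fun x => ‖(φ n).polarize hσ hΩ hε (hφ n) x - φ n x‖) +
            fun x => ‖φ n (σ x) - u (σ x)‖) 2 (volume.restrict U) := by
          refine eLpNorm_mono_ae ?_
          filter_upwards [ae_restrict_mem hUo.measurableSet] with x hx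
          have h3 : (φ n).polarize hσ hΩ hε (hφ n) x - φ n x =
              -smoothRamp ε (φ n x - φ n (σ x)) := by
            have : ¬ h (σ x) < 0 := by
              rw [hσ.side_apply]
              exact not_lt.2 (neg_nonneg.2 (le_of_lt hx.2))
            rw [TestFunction.polarize_apply, polarTransfer, polarTransfer, if_neg this,
              if_pos (show h x < 0 from hx.2)]
            ring
          simp only [Pi.add_apply]
          rw [Real.norm_of_nonneg (le_max_right _ _), Real.norm_of_nonneg (by positivity)]
          refine max_le ?_ (by positivity)
          rw [h3, norm_neg, Real.norm_of_nonneg (smoothRamp_nonneg hε _), Real.norm_eq_abs,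
            Real.norm_eq_abs]
          linarith [sub_le_smoothRamp hε (φ n x - φ n (σ x)), neg_abs_le (φ n x - u x),
            le_abs_self (φ n (σ x) - u (σ x))]
      _ ≤ eLpNorm (fun x => φ n x - u x) 2 (volume.restrict U) +
          eLpNorm (fun x => (φ n).polarize hσ hΩ hε (hφ n) x - φ n x) 2 (volume.restrict U) +
          eLpNorm (fun x => φ n (σ x) - u (σ x)) 2 (volume.restrict U) := by
          refine (eLpNorm_add_le (hm1.norm.add hm2.norm) hm3.norm (by norm_num)).trans ?_
          rw [eLpNorm_norm]
          refine add_le_add ?_ le_rfl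
          refine (eLpNorm_add_le hm1.norm hm2.norm (by norm_num)).trans ?_
          rw [eLpNorm_norm, eLpNorm_norm]
      _ ≤ _ := by
          refine add_le_add (add_le_add ?_ (eLpNorm_restrict_le _ 2 volume U)) ?_
          · exact eLpNorm_mono_measure _ (Measure.restrict_mono Set.inter_subset_left le_rfl)
          · exact (eLpNorm_mono_measure (fun x => φ n (σ x) - u (σ x)) hle).trans_eq hcomp
  intro x hx hhx
  refine le_of_forall_pos_le_add fun δ hδ => ?_
  have := main (δ / 2) (by positivity) x ⟨hx, hhx⟩
  linarith

end Polarization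

/-! ### The reflection which exchanges two vertices -/

section Reflection

open scoped ComplexConjugate

/-- The difference of the squared distances to `C` and `B`; it is positive on the side of `B` of the
perpendicular bisector. -/
noncomputable def bisectorSide (B C x : ℂ) : ℝ := ‖x - C‖ ^ 2 - ‖x - B‖ ^ 2

/-- The linear isometry `z ↦ exp (θ * I) * conj z`. -/
noncomputable def conjRotation (θ : ℝ) : ℂ ≃ₗᵢ[ℝ] ℂ :=
  Complex.conjLIE.trans (rotation (Circle.exp θ))

theorem conjRotation_apply (θ : ℝ) (z : ℂ) :
    conjRotation θ z = Complex.exp (θ * Complex.I) * conj z := by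
  simp [conjRotation, rotation_apply]

theorem conj_exp_mul_I (x : ℝ) :
    conj (Complex.exp (x * Complex.I)) = Complex.exp (-(x * Complex.I)) := by
  rw [← Complex.exp_conj]
  simp

theorem conjRotation_polar (θ s x : ℝ) :
    conjRotation θ (s * Complex.exp (x * Complex.I)) =
      s * Complex.exp ((θ - x : ℝ) * Complex.I) := by
  rw [conjRotation_apply, map_mul, conj_exp_mul_I, Complex.conj_ofReal, mul_left_comm,
    ← Complex.exp_add]
  congr 2
  push_cast
  ring

theorem conjRotation_conjRotation (θ : ℝ) (z : ℂ) : conjRotation θ (conjRotation θ z) = z := by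
  rw [conjRotation_apply, conjRotation_apply, map_mul, conj_exp_mul_I, Complex.conj_conj,
    ← mul_assoc, ← Complex.exp_add]
  simp

/-- The reflection about a line through `O`. -/
noncomputable def reflectAbout (O : ℂ) (θ : ℝ) (x : ℂ) : ℂ := O + conjRotation θ (x - O)

theorem reflectAbout_involutive (O : ℂ) (θ : ℝ) : Function.Involutive (reflectAbout O θ) := by
  intro x
  simp [reflectAbout, conjRotation_conjRotation]

theorem norm_reflectAbout_sub (O : ℂ) (θ : ℝ) (x y : ℂ) :
    ‖reflectAbout O θ x - reflectAbout O θ y‖ = ‖x - y‖ := by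
  rw [reflectAbout, reflectAbout, add_sub_add_left_eq_sub, ← map_sub,
    LinearIsometryEquiv.norm_map, sub_sub_sub_cancel_right]

/-- Writing the reflection as multiplication of the conjugate by a unit `k`, all conjugates except
that of `x - O` can be eliminated, leaving a polynomial identity modulo `k * conj k = 1`. -/
theorem reflectAbout_eq_sub (O : ℂ) {θ : ℝ} {B C : ℂ} (hBC : reflectAbout O θ B = C) (x : ℂ) :
    ‖B - C‖ ^ 2 • reflectAbout O θ x = ‖B - C‖ ^ 2 • x - bisectorSide B C x • (B - C) := by
  have hCB : reflectAbout O θ C = B := by rw [← hBC, reflectAbout_involutive]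
  rw [reflectAbout, conjRotation_apply] at hBC hCB ⊢
  set k := Complex.exp (θ * Complex.I) with hk
  have hkk : k * conj k = 1 := by
    rw [hk, conj_exp_mul_I, ← Complex.exp_add]
    simp
  have e : ∀ z : ℂ, ((‖z‖ ^ 2 : ℝ) : ℂ) = z * conj z := fun z => by
    rw [Complex.mul_conj']; push_cast; rfl
  have hb : conj (B - O) = conj k * (C - O) := by
    linear_combination (-conj (B - O)) * hkk + conj k * hBC
  have hc : conj (C - O) = conj k * (B - O) := by
    linear_combination (-conj (C - O)) * hkk + conj k * hCB
  have h1 : conj (B - C) = conj k * (C - B) := by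
    have : B - C = (B - O) - (C - O) := by ring
    rw [this, map_sub, hb, hc]; ring
  have h2 : conj (x - C) = conj (x - O) - conj k * (B - O) := by rw [← hc, ← map_sub]; ring_nf
  have h3 : conj (x - B) = conj (x - O) - conj k * (C - O) := by rw [← hb, ← map_sub]; ring_nf
  rw [bisectorSide, Complex.real_smul, Complex.real_smul, Complex.real_smul, Complex.ofReal_sub,
    e, e, e, h1, h2, h3]
  linear_combination (-(B - C) ^ 2 * conj (x - O)) * hkk

theorem isLineReflection_reflectAbout (O : ℂ) {θ : ℝ} {B C : ℂ} (hBC : reflectAbout O θ B = C)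
    (hne : B ≠ C) : IsLineReflection (reflectAbout O θ) (bisectorSide B C) where
  contDiff := contDiff_const.add
    ((conjRotation θ).contDiff.comp (contDiff_id.sub contDiff_const))
  exists_hasFDerivAt := ⟨conjRotation θ, fun x => by
    have h := ((conjRotation θ).toContinuousLinearEquiv.hasFDerivAt (x := x - O)).comp x
      ((hasFDerivAt_id x).sub_const O)
    rw [ContinuousLinearMap.comp_id] at h
    exact h.const_add O⟩
  measurePreserving := (measurePreserving_add_left volume O).comp
    ((conjRotation θ).measurePreserving.comp (measurePreserving_sub_right volume O))
  involutive := reflectAbout_involutive O θ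
  continuous_side := by unfold bisectorSide; fun_prop
  side_apply x := by
    have hCB : reflectAbout O θ C = B := by rw [← hBC, reflectAbout_involutive]
    have h1 := norm_reflectAbout_sub O θ x B
    have h2 := norm_reflectAbout_sub O θ x C
    rw [hBC] at h1
    rw [hCB] at h2
    rw [bisectorSide, bisectorSide, h1, h2]
    ring
  fixed x hx := by
    have h := reflectAbout_eq_sub O hBC x
    rw [hx, zero_smul, sub_zero] at h
    exact smul_right_injective ℂ (pow_ne_zero 2 (norm_ne_zero_iff.2 (sub_ne_zero.2 hne))) h

theorem bisectorSide_add {O B C : ℂ} (h : ‖B - O‖ = ‖C - O‖) (v : ℂ) :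
    bisectorSide B C (O + v) = 2 * inner ℝ v (B - C) := by
  have e1 : O + v - C = v - (C - O) := by ring
  have e2 : O + v - B = v - (B - O) := by ring
  have e3 : B - C = (B - O) - (C - O) := by ring
  rw [bisectorSide, e1, e2, e3, norm_sub_sq_real v, norm_sub_sq_real v, h,
    inner_sub_right v (B - O) (C - O)]
  ring

theorem bisectorSide_self (B C : ℂ) : bisectorSide B C B = ‖B - C‖ ^ 2 := by
  simp [bisectorSide]

theorem bisectorSide_self_right (B C : ℂ) : bisectorSide B C C = -‖B - C‖ ^ 2 := by
  simp [bisectorSide, norm_sub_rev]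

end Reflection

/-! ### Hulls of a disk and points -/

section Hull

/-- The weight left over by the vertices goes to the disk point `O + s⁻¹ • e`. With
`exists_of_mem_capHull` this describes the hull by vertex weights and a remainder `e`. -/
theorem add_mem_of_convex {K : Set ℂ} (hK : Convex ℝ K) {O A B C : ℂ} {r : ℝ}
    (hball : Metric.closedBall O r ⊆ K) (hr : 0 ≤ r) (hA : A ∈ K) (hB : B ∈ K) (hC : C ∈ K)
    {a b c : ℝ} (ha : 0 ≤ a) (hb : 0 ≤ b) (hc : 0 ≤ c) (hs : a + b + c ≤ 1) {e : ℂ}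
    (he : ‖e‖ ≤ (1 - a - b - c) * r) :
    O + (a • (A - O) + b • (B - O) + c • (C - O) + e) ∈ K := by
  set s := 1 - a - b - c with hsdef
  have hs0 : 0 ≤ s := by linarith
  have hd : O + s⁻¹ • e ∈ K := by
    refine hball ?_
    rw [mem_closedBall_iff_norm, add_sub_cancel_left, norm_smul, Real.norm_of_nonneg (by positivity)]
    rcases hs0.eq_or_lt with h | h
    · rw [← h, inv_zero, zero_mul]; exact hr
    · rw [inv_mul_le_iff₀ h]; exact he
  have hse : s • s⁻¹ • e = e := by
    rcases hs0.eq_or_lt with h | h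
    · rw [← h, zero_mul] at he
      rw [norm_le_zero_iff.1 he, smul_zero, smul_zero]
    · exact smul_inv_smul₀ h.ne' e
  have := hK.sum_mem (t := Finset.univ) (w := ![a, b, c, s]) (z := ![A, B, C, O + s⁻¹ • e])
    (fun i _ => by fin_cases i <;> assumption)
    (by simp [Fin.sum_univ_four, hsdef])
    (fun i _ => by fin_cases i <;> assumption)
  convert this using 1
  simp only [Fin.sum_univ_four, Matrix.cons_val, smul_add, hse]
  rw [hsdef]
  module

theorem exists_of_mem_capHull {O A B C : ℂ} {r : ℝ} (hr : 0 ≤ r) {x : ℂ}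
    (hx : x ∈ capHull O r A B C) :
    ∃ a b c : ℝ, ∃ e : ℂ, 0 ≤ a ∧ 0 ≤ b ∧ 0 ≤ c ∧ a + b + c ≤ 1 ∧
      ‖e‖ ≤ (1 - a - b - c) * r ∧
      x = O + (a • (A - O) + b • (B - O) + c • (C - O) + e) := by
  have hne : (Metric.closedBall O r).Nonempty := ⟨O, Metric.mem_closedBall_self hr⟩
  have e1 : Metric.closedBall O r ∪ {A, B, C} =
      insert A (insert B (insert C (Metric.closedBall O r))) := by
    ext y; simp only [Set.mem_union, Set.mem_insert_iff, Set.mem_singleton_iff]; tauto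
  rw [capHull, e1, convexHull_insert (Set.insert_nonempty _ _),
    convexHull_insert (Set.insert_nonempty _ _), convexHull_insert hne,
    (convex_closedBall O r).convexHull_eq] at hx
  simp only [convexJoin_singleton_left, Set.mem_iUnion, exists_prop] at hx
  obtain ⟨y, ⟨z, ⟨d, hd, p₃, q₃, hp₃, hq₃, h₃, rfl⟩, p₂, q₂, hp₂, hq₂, h₂, rfl⟩,
    p₁, q₁, hp₁, hq₁, h₁, rfl⟩ := hx
  have hs : 1 - p₁ - q₁ * p₂ - q₁ * (q₂ * p₃) = q₁ * (q₂ * q₃) := by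
    linear_combination (-1 : ℝ) * h₁ - q₁ * h₂ - q₁ * q₂ * h₃
  refine ⟨p₁, q₁ * p₂, q₁ * (q₂ * p₃), (q₁ * (q₂ * q₃)) • (d - O), hp₁, by positivity,
    by positivity, ?_, ?_, ?_⟩
  · have : 0 ≤ q₁ * (q₂ * q₃) := by positivity
    linarith
  · rw [hs, norm_smul, Real.norm_of_nonneg (by positivity)]
    exact mul_le_mul_of_nonneg_left (mem_closedBall_iff_norm.1 hd) (by positivity)
  · have : q₃ = 1 - p₃ := by linarith
    subst this
    have : q₂ = 1 - p₂ := by linarith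
    subst this
    have : q₁ = 1 - p₁ := by linarith
    subst this
    module

theorem closedBall_subset_capHull (O : ℂ) (r : ℝ) (A B C : ℂ) :
    Metric.closedBall O r ⊆ capHull O r A B C :=
  Set.subset_union_left.trans (subset_convexHull ℝ _)

/-- If `A` is closer to `B` than to `C`, the reflection which exchanges `B` and `C` maps the side of
`C` of the hull into the hull. -/
theorem reflectAbout_mem_capHull {O A B C : ℂ} {r θ : ℝ} (hr : 0 ≤ r)
    (hBC : reflectAbout O θ B = C) (hne : B ≠ C) (hn : ‖B - O‖ = ‖C - O‖)
    (hA : 0 ≤ bisectorSide B C A) {x : ℂ} (hx : x ∈ capHull O r A B C)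
    (hside : bisectorSide B C x < 0) : reflectAbout O θ x ∈ capHull O r A B C := by
  obtain ⟨a, b, c, e, ha, hb, hc, hs, he, rfl⟩ := exists_of_mem_capHull hr hx
  set p : ℂ := a • (A - O) + b • (B - O) + c • (C - O) with hp
  have hN : 0 < ‖B - C‖ ^ 2 := pow_pos (norm_pos_iff.2 (sub_ne_zero.2 hne)) 2
  have hmem : ∀ y, y ∈ ({A, B, C} : Set ℂ) → y ∈ capHull O r A B C := fun y hy =>
    subset_convexHull ℝ _ (Or.inr hy)
  have hK := fun {a b c : ℝ} ha hb hc hs {e : ℂ} he => add_mem_of_convex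
    (convex_convexHull ℝ (Metric.closedBall O r ∪ {A, B, C}))
    (closedBall_subset_capHull O r A B C) hr (hmem A (by simp)) (hmem B (by simp))
    (hmem C (by simp)) (a := a) (b := b) (c := c) ha hb hc hs (e := e) he
  have hrefl : ∀ y, reflectAbout O θ y = y - (bisectorSide B C y / ‖B - C‖ ^ 2) • (B - C) := by
    intro y
    have h := congrArg (fun z => (‖B - C‖ ^ 2)⁻¹ • z) (reflectAbout_eq_sub O hBC y)
    simp only [smul_sub, inv_smul_smul₀ hN.ne', smul_smul] at h
    rw [h, smul_sub, div_eq_inv_mul]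
  have hsA : bisectorSide B C A = 2 * inner ℝ (A - O) (B - C) := by
    rw [← bisectorSide_add hn, add_sub_cancel]
  have hsB : ‖B - C‖ ^ 2 = 2 * inner ℝ (B - O) (B - C) := by
    rw [← bisectorSide_self, ← bisectorSide_add hn, add_sub_cancel]
  have hsC : -‖B - C‖ ^ 2 = 2 * inner ℝ (C - O) (B - C) := by
    rw [← bisectorSide_self_right, ← bisectorSide_add hn, add_sub_cancel]
  have hsp : bisectorSide B C (O + p) = a * bisectorSide B C A + (b - c) * ‖B - C‖ ^ 2 := by
    rw [bisectorSide_add hn, hp, inner_add_left, inner_add_left, real_inner_smul_left,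
      real_inner_smul_left, real_inner_smul_left, hsA]
    linear_combination (-b) * hsB - c * hsC
  -- If the vertex part `O + p` is on the side of `C`, reflecting it shifts weight `l` from `C` to
  -- `B`; `l ≤ c - b` because `A` contributes nonnegatively. Otherwise the weights are kept: the
  -- reflected point is at least as close to `O + p` as the original, so it is an admissible
  -- remainder.
  rcases le_or_gt (bisectorSide B C (O + p)) 0 with hle | hgt
  · set l := -(bisectorSide B C (O + p) / ‖B - C‖ ^ 2) with hl
    have hl0 : 0 ≤ l := neg_nonneg.2 (div_nonpos_of_nonpos_of_nonneg hle hN.le)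
    have hlc : l ≤ c - b := by
      rw [hl, hsp, ← neg_div, div_le_iff₀ hN]
      nlinarith [mul_nonneg ha hA]
    have hσ : reflectAbout O θ (O + (p + e)) =
        O + (a • (A - O) + (b + l) • (B - O) + (c - l) • (C - O) + conjRotation θ e) := by
      have h1 : reflectAbout O θ (O + (p + e)) = reflectAbout O θ (O + p) + conjRotation θ e := by
        simp only [reflectAbout, add_sub_cancel_left, map_add]
        ring
      rw [h1, hrefl (O + p), sub_eq_add_neg, ← neg_smul, ← hl, hp]
      module
    rw [hσ]
    refine hK ha (by linarith) (by linarith) (by linarith) ?_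
    rw [LinearIsometryEquiv.norm_map]
    convert he using 2
    ring
  · have hσ : reflectAbout O θ (O + (p + e)) =
        O + (p + (reflectAbout O θ (O + (p + e)) - (O + p))) := by ring
    rw [hσ]
    refine hK ha hb hc hs (le_trans ?_ he)
    refine le_of_sq_le_sq ?_ (norm_nonneg _)
    set m := bisectorSide B C (O + (p + e)) / ‖B - C‖ ^ 2 with hm
    have hm0 : m < 0 := div_neg_of_neg_of_pos hside hN
    have hmN : m * ‖B - C‖ ^ 2 = bisectorSide B C (O + (p + e)) := div_mul_cancel₀ _ hN.ne'
    have h2 : reflectAbout O θ (O + (p + e)) - (O + p) = e - m • (B - C) := by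
      rw [hrefl]; ring
    rw [h2, norm_sub_sq_real, real_inner_smul_right, norm_smul, mul_pow, Real.norm_eq_abs, sq_abs]
    have h3 : 2 * inner ℝ e (B - C) = bisectorSide B C (O + (p + e)) - bisectorSide B C (O + p) := by
      rw [bisectorSide_add hn, bisectorSide_add hn, inner_add_left]; ring
    nlinarith [mul_pos (neg_pos.2 hm0) hgt]

end Hull

/-! ### The arcs -/

section Arcs

theorem norm_polar {s : ℝ} (hs : 0 ≤ s) (x : ℝ) : ‖(s : ℂ) * Complex.exp (x * Complex.I)‖ = s := by
  rw [norm_mul, Complex.norm_exp_ofReal_mul_I, mul_one, Complex.norm_real, Real.norm_of_nonneg hs]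

theorem inner_polar (s R x y : ℝ) :
    inner ℝ ((s : ℂ) * Complex.exp (x * Complex.I)) ((R : ℂ) * Complex.exp (y * Complex.I)) =
      s * R * Real.cos (x - y) := by
  rw [Complex.inner, Complex.mul_re, Complex.conj_re, Complex.conj_im, Complex.re_ofReal_mul,
    Complex.re_ofReal_mul, Complex.im_ofReal_mul, Complex.im_ofReal_mul,
    Complex.exp_ofReal_mul_I_re, Complex.exp_ofReal_mul_I_re, Complex.exp_ofReal_mul_I_im,
    Complex.exp_ofReal_mul_I_im, Real.cos_sub]
  ring

theorem sub_eq_polar {O P : ℂ} {R : ℝ} (h : dist P O = R) :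
    P - O = (R : ℂ) * Complex.exp ((P - O).arg * Complex.I) := by
  rw [← h, dist_eq_norm, Complex.norm_mul_exp_arg_mul_I]

theorem capArc_sub (O : ℂ) (r : ℝ) (P : ℂ) (t : ℝ) :
    capArc O r P t - O = (r : ℂ) * Complex.exp (((P - O).arg - capAngle r + t : ℝ) * Complex.I) := by
  rw [capArc, add_sub_cancel_left]

theorem capArc_mem_closedBall (O : ℂ) {r : ℝ} (hr : 0 ≤ r) (P : ℂ) (t : ℝ) :
    capArc O r P t ∈ Metric.closedBall O r := by
  rw [mem_closedBall_iff_norm, capArc_sub, norm_polar hr]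

theorem continuous_capArc (O : ℂ) (r : ℝ) (P : ℂ) : Continuous (capArc O r P) := by
  unfold capArc
  fun_prop

/-- The reflection sends polar angle `x` to `θ - x`, so taking for `θ` the sum of the two arguments
exchanges them. -/
theorem reflectAbout_eq_of_dist_eq {O B C : ℂ} {R : ℝ} (hB : dist B O = R) (hC : dist C O = R) :
    reflectAbout O ((B - O).arg + (C - O).arg) B = C := by
  have h := conjRotation_polar ((B - O).arg + (C - O).arg) R (B - O).arg
  rw [← sub_eq_polar hB, add_sub_cancel_left, ← sub_eq_polar hC] at h
  rw [reflectAbout, h, add_sub_cancel]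

theorem reflectAbout_capArc (O : ℂ) (r : ℝ) (B C : ℂ) (t : ℝ) :
    reflectAbout O ((B - O).arg + (C - O).arg) (capArc O r B t) =
      capArc O r C (2 * capAngle r - t) := by
  rw [reflectAbout, capArc_sub, conjRotation_polar, capArc]
  congr 4
  push_cast
  ring

/-- Just outside an interior point of the arc cut out by the tangents from `P`, there is a point of
the ray from `O` which belongs to the cap at `P`. -/
theorem exists_smul_mem_hull {O P : ℂ} {r : ℝ} (hr : r ∈ Set.Icc (1 / 3 : ℝ) (1 / 2))
    (hP : dist P O = 1 - r) {t : ℝ} (ht : |t - capAngle r| < capAngle r) :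
    ∃ s k : ℝ, 0 ≤ s ∧ s ≤ 1 ∧ 1 < k ∧
      ‖k • (capArc O r P t - O) - s • (P - O)‖ ≤ (1 - s) * r := by
  obtain ⟨h1, h2⟩ := hr
  have hr0 : 0 < r := by linarith
  have hR0 : 0 < 1 - r := by linarith
  have hcos : r / (1 - r) < Real.cos (t - capAngle r) := by
    have hle : r / (1 - r) ≤ 1 := (div_le_one hR0).2 (by linarith)
    rw [← Real.cos_arccos (by linarith [div_nonneg hr0.le hR0.le] : -1 ≤ r / (1 - r)) hle,
      ← Real.cos_abs (t - capAngle r)]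
    exact Real.cos_lt_cos_of_nonneg_of_le_pi (abs_nonneg _) (Real.arccos_le_pi _) ht
  have hm : 0 < 2 * r * ((1 - r) * Real.cos (t - capAngle r) - r) := by
    rw [div_lt_iff₀ hR0] at hcos
    have : 0 < (1 - r) * Real.cos (t - capAngle r) - r := by linarith
    positivity
  set m := 2 * r * ((1 - r) * Real.cos (t - capAngle r) - r) with hmdef
  -- After expanding squares, `‖v - s • (P - O)‖ < (1 - s) * r` amounts to `s * (1 - 2 * r) < m`,
  -- which holds for this small `s`.
  set s := min (1 / 2) (m / 2) with hsdef
  have hs0 : 0 < s := lt_min (by norm_num) (by positivity)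
  have hs1 : s ≤ 1 / 2 := min_le_left _ _
  have hsm : s ≤ m / 2 := min_le_right _ _
  set v := capArc O r P t - O with hv
  have hvn : ‖v‖ = r := by rw [hv, capArc_sub, norm_polar hr0.le]
  have hPn : ‖P - O‖ = 1 - r := by rw [← dist_eq_norm, hP]
  have hin : inner ℝ v (P - O) = r * (1 - r) * Real.cos (t - capAngle r) := by
    have h := inner_polar r (1 - r) ((P - O).arg - capAngle r + t) (P - O).arg
    rw [← capArc_sub, ← sub_eq_polar hP] at h
    rw [h]
    congr 2
    ring
  have hlt : ‖v - s • (P - O)‖ < (1 - s) * r := by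
    refine lt_of_pow_lt_pow_left₀ 2 (mul_nonneg (by linarith) hr0.le) ?_
    rw [norm_sub_sq_real, real_inner_smul_right, norm_smul, Real.norm_of_nonneg hs0.le, hvn, hPn,
      hin]
    have : s * (1 - 2 * r) < m := by nlinarith
    nlinarith [mul_lt_mul_of_pos_left this hs0]
  -- The slack in the strict inequality is spent on stretching `v`, whose norm is `r`.
  refine ⟨s, 1 + ((1 - s) * r - ‖v - s • (P - O)‖) / r, hs0.le, by linarith,
    lt_add_of_pos_right _ (div_pos (sub_pos.2 hlt) hr0), ?_⟩
  set d := (1 - s) * r - ‖v - s • (P - O)‖ with hd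
  have hd0 : 0 < d := sub_pos.2 hlt
  calc ‖(1 + d / r) • v - s • (P - O)‖ = ‖(v - s • (P - O)) + (d / r) • v‖ := by
        congr 1; module
    _ ≤ ‖v - s • (P - O)‖ + ‖(d / r) • v‖ := norm_add_le _ _
    _ = (1 - s) * r := by
        rw [norm_smul, Real.norm_of_nonneg (by positivity), hvn, div_mul_cancel₀ _ hr0.ne', hd]
        ring

theorem mem_cap_of_norm_sub_smul_le {O P w : ℂ} {r s : ℝ} (hr : 0 ≤ r) (hs0 : 0 ≤ s) (hs1 : s ≤ 1)
    (hw : r < ‖w‖) (h : ‖w - s • (P - O)‖ ≤ (1 - s) * r) : O + w ∈ cap O r P := by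
  refine ⟨?_, ?_⟩
  · have hP : P ∈ convexHull ℝ (insert P (Metric.closedBall O r)) :=
      subset_convexHull ℝ _ (Set.mem_insert _ _)
    have := add_mem_of_convex (convex_convexHull ℝ (insert P (Metric.closedBall O r)))
      ((Set.subset_insert _ _).trans (subset_convexHull ℝ _)) hr hP hP hP hs0 le_rfl le_rfl
      (by linarith) (e := w - s • (P - O)) (by simpa using h)
    convert this using 2
    simp
  · rw [mem_closedBall_iff_norm, add_sub_cancel_left]
    exact not_le.2 hw

/-- When the caps at `B` and `C` are disjoint, the arc at `B` lies on the side of `B` of the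
perpendicular bisector. -/
theorem bisectorSide_capArc_nonneg {O B C : ℂ} {r : ℝ} (hr : r ∈ Set.Icc (1 / 3 : ℝ) (1 / 2))
    (hB : dist B O = 1 - r) (hC : dist C O = 1 - r) (hne : B ≠ C)
    (hd : Disjoint (cap O r B) (cap O r C)) {t : ℝ} (ht : t ∈ Set.Icc 0 (2 * capAngle r)) :
    0 ≤ bisectorSide B C (capArc O r B t) := by
  by_contra! hlt
  have hr0 : 0 < r := by linarith [hr.1]
  have hR0 : 0 < 1 - r := by linarith [hr.2]
  have hn : ‖B - O‖ = ‖C - O‖ := by rw [← dist_eq_norm, ← dist_eq_norm, hB, hC]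
  set θ := (B - O).arg + (C - O).arg
  have hBC : reflectAbout O θ B = C := reflectAbout_eq_of_dist_eq hB hC
  have hσ := isLineReflection_reflectAbout O hBC hne
  have hside : ∀ v, bisectorSide B C (O + v) = 2 * inner ℝ v (B - C) := bisectorSide_add hn
  have hmid : 0 < bisectorSide B C (capArc O r B (capAngle r)) := by
    have e : capArc O r B (capAngle r) = O + (r / (1 - r)) • (B - O) := by
      rw [sub_eq_polar hB, capArc, sub_add_cancel, Complex.real_smul, ← mul_assoc,
        ← Complex.ofReal_mul, div_mul_cancel₀ _ hR0.ne']
    have h2 := hside (B - O)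
    rw [add_sub_cancel, bisectorSide_self] at h2
    rw [e, hside, real_inner_smul_left, mul_left_comm, ← h2]
    have := norm_pos_iff.2 (sub_ne_zero.2 hne)
    positivity
  have hcont : Continuous fun τ => bisectorSide B C (capArc O r B τ) :=
    hσ.continuous_side.comp (continuous_capArc O r B)
  -- The midpoint of the arc is on the side of `B`, so an arc reaching the other side crosses the
  -- bisector at an interior parameter. Pushed slightly outward along its ray, the crossing point is
  -- in the cap at `B` and fixed by the reflection, hence also in the cap at `C`.
  obtain ⟨τ, hτ, h0⟩ : ∃ τ ∈ Set.uIcc t (capAngle r), bisectorSide B C (capArc O r B τ) = 0 :=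
    intermediate_value_uIcc hcont.continuousOn (Set.mem_uIcc.2 (Or.inl ⟨hlt.le, hmid.le⟩))
  have hτt : τ ≠ t := fun h => by rw [h] at h0; exact hlt.ne h0
  have habs : |τ - capAngle r| < capAngle r := by
    rw [abs_lt]
    rcases Set.mem_uIcc.1 hτ with ⟨ha, hb⟩ | ⟨ha, hb⟩
    · have := lt_of_le_of_ne ha (Ne.symm hτt)
      constructor <;> linarith [ht.1]
    · have := lt_of_le_of_ne hb hτt
      constructor <;> linarith [ht.2, ht.1]
  obtain ⟨s, k, hs0, hs1, hk, hle⟩ := exists_smul_mem_hull hr hB habs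
  set w := k • (capArc O r B τ - O) with hw
  have hwn : r < ‖w‖ := by
    rw [hw, norm_smul, capArc_sub, norm_polar hr0.le, Real.norm_of_nonneg (by linarith)]
    nlinarith
  have hfix : reflectAbout O θ (O + w) = O + w := by
    refine hσ.fixed _ ?_
    have h3 := hside (capArc O r B τ - O)
    rw [add_sub_cancel, h0] at h3
    rw [hside, hw, real_inner_smul_left, mul_left_comm, ← h3, mul_zero]
  refine Set.disjoint_left.1 hd (mem_cap_of_norm_sub_smul_le hr0.le hs0 hs1 hwn hle)
    (mem_cap_of_norm_sub_smul_le hr0.le hs0 hs1 hwn ?_)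
  have hw' : conjRotation θ w = w := by
    rwa [reflectAbout, add_sub_cancel_left, add_right_inj] at hfix
  have hC' : conjRotation θ (B - O) = C - O := by
    rw [← hBC, reflectAbout, add_sub_cancel_left]
  rw [← hC', ← hw', ← map_smul, ← map_sub, LinearIsometryEquiv.norm_map]
  exact hle

end Arcs

theorem mainTheorem8 (O : ℂ) (r : ℝ) (A B C : ℂ) (hT : IsThreeCap O r A B C)
    (hAB : dist A B < dist A C) (u : ℂ → ℝ) (hu : IsTorsionFunction (capHull O r A B C) u) :
    ∀ t ∈ Set.Icc (0 : ℝ) (2 * capAngle r),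
      u (capArc O r C (2 * capAngle r - t)) ≤ u (capArc O r B t) := by
  intro t ht
  have hr0 : 0 ≤ r := by linarith [hT.r_mem.1]
  have hne : B ≠ C := fun h => by rw [h] at hAB; exact lt_irrefl _ hAB
  have hn : ‖B - O‖ = ‖C - O‖ := by
    rw [← dist_eq_norm, ← dist_eq_norm, hT.dist_B, hT.dist_C]
  set θ := (B - O).arg + (C - O).arg
  have hBC : reflectAbout O θ B = C := reflectAbout_eq_of_dist_eq hT.dist_B hT.dist_C
  have hσ := isLineReflection_reflectAbout O hBC hne
  set K := capHull O r A B C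
  have hA : 0 ≤ bisectorSide B C A := by
    rw [bisectorSide, ← dist_eq_norm, ← dist_eq_norm, sub_nonneg]
    gcongr
  have hΩ : ∀ x ∈ interior K, bisectorSide B C x < 0 → reflectAbout O θ x ∈ interior K := by
    intro x hx hxs
    -- An open image contained in `K` lies in the interior.
    have ho : IsOpen (reflectAbout O θ '' (interior K ∩ {y | bisectorSide B C y < 0})) :=
      hσ.toHomeomorph.isOpenMap _
        (isOpen_interior.inter (isOpen_lt hσ.continuous_side continuous_const))
    refine interior_maximal ?_ ho (Set.mem_image_of_mem _ ⟨hx, hxs⟩)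
    rintro _ ⟨y, ⟨hy, hys⟩, rfl⟩
    exact reflectAbout_mem_capHull hr0 hBC hne hn hA (interior_subset hy) hys
  have hbd : Bornology.IsBounded K :=
    isBounded_convexHull.2 (Metric.isBounded_closedBall.union (Set.toFinite _).isBounded)
  have hbi : Bornology.IsBounded (interior K) := hbd.subset interior_subset
  have hfr : ∀ {y}, y ∈ K → y ∉ interior K → u y = 0 := fun hy hyi =>
    hu.zero_frontier _ ⟨subset_closure hy, hyi⟩
  have hmem : ∀ P τ, capArc O r P τ ∈ K := fun P τ =>
    closedBall_subset_capHull O r A B C (capArc_mem_closedBall O hr0 P τ)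
  have hxs := bisectorSide_capArc_nonneg hT.r_mem hT.dist_B hT.dist_C hne hT.disjoint_BC ht
  have hyx : reflectAbout O θ (capArc O r B t) = capArc O r C (2 * capAngle r - t) :=
    reflectAbout_capArc O r B C t
  have hxy : reflectAbout O θ (capArc O r C (2 * capAngle r - t)) = capArc O r B t := by
    rw [← hyx, hσ.involutive]
  -- Arc points may lie on the boundary of `K`. If the one at `C` does, its value is `0` and
  -- nonnegativity suffices; if the two points lie on the bisector, they coincide.
  by_cases hy : capArc O r C (2 * capAngle r - t) ∈ interior K
  · rcases hxs.lt_or_eq with h | h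
    · have := hu.weakSolution.le_comp_reflection hσ hbi hΩ hu.continuousOn _ hy
        (by rw [← hyx, hσ.side_apply]; linarith)
      rwa [hxy] at this
    · rw [← hyx, hσ.fixed _ h.symm]
  · rw [hfr (hmem _ _) hy]
    by_cases hx : capArc O r B t ∈ interior K
    · exact hu.weakSolution.nonneg hbi hu.continuousOn _ hx
    · exact (hfr (hmem _ _) hx).ge
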